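/- For $1\le p<\infty$ let $\|A\|_p=\operatorname{Tr}(|A|^p)^{1/p}$, $|A|=\sqrt{A^*A}$, be the (unnormalized) Schatten $p$-norm on $M_d(\mathbb C)$, and let $\|A\|_\infty$ be the operator norm. For $1\le p\le\infty$, a group $\Gamma$ is called $\mathscr G_p$-approximated if there are dimensions $d_n\in\mathbb N$ and maps $\varphi_n:\Gamma\to U(d_n)$, $n\in\mathbb N$ (not necessarily homomorphisms), such that $$\lim_{n\to\infty}\|\varphi_n(gh)-\varphi_n(g)\varphi_n(h)\|_p=0\quad\text{for all } g,h\in\Gamma,\qquad \liminf_{n\to\infty}\|\varphi_n(g)-1\|_p>0\quad\text{for all } g\in\Gamma\setminus\{1\}.$$ **Proposition.** Let $\Gamma$ be a finitely generated group with a finite normal subgroup $N$. 1. Let $1\le p\le q\le\infty$ and suppose that $\Gamma/N$ is $\mathscr G_q$-approximated. If $\Gamma$ is $\mathscr G_p$-approximated, then $\Gamma$ is $\mathscr G_q$-approximated. 2. In particular, if $\Gamma/N$ is residually finite, then for all $1\le p\le q\le\infty$: if $\Gamma$ is $\mathscr G_p$-approximated, then $\Gamma$ is $\mathscr G_q$-approximated.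 -/

import Mathlib

open Filter Topology
open scoped ENNReal Matrix

noncomputable section

open scoped MatrixOrder Matrix.Norms.L2Operator in
/-- The (unnormalized) Schatten `p`-norm of a square complex matrix: `Tr(|A|^p)^(1/p)` with
`|A| = √(A* A)` for finite `p`, and the operator norm on Euclidean space for `p = ∞`. -/
def schattenNorm (p : ℝ≥0∞) {d : ℕ} (A : Matrix (Fin d) (Fin d) ℂ) : ℝ :=
  if p = ∞ then ‖A‖
  else (Matrix.trace (CFC.abs A ^ p.toReal)).re ^ (1 / p.toReal)

/-- The distance on `U(d)` induced by the Schatten `p`-norm. -/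
def schattenDist (p : ℝ≥0∞) {d : ℕ} (u v : Matrix.unitaryGroup (Fin d) ℂ) : ℝ :=
  schattenNorm p ((u : Matrix (Fin d) (Fin d) ℂ) - (v : Matrix (Fin d) (Fin d) ℂ))

/-- The maps `φ n : Γ → U(d n)` form an asymptotic homomorphism for the Schatten `p`-norm. -/
def IsAsymptoticHom (p : ℝ≥0∞) {Γ : Type*} [Group Γ] {d : ℕ → ℕ}
    (φ : ∀ n, Γ → Matrix.unitaryGroup (Fin (d n)) ℂ) : Prop :=
  ∀ g h : Γ, Tendsto (fun n => schattenDist p (φ n (g * h)) (φ n g * φ n h)) atTop (𝓝 0)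

/-- The maps `φ n : Γ → U(d n)` asymptotically separate `Γ` for the Schatten `p`-norm. The lower
limit is taken in `[0, ∞]`, since the distances may be unbounded in `n`. -/
def AsymptoticallySeparates (p : ℝ≥0∞) {Γ : Type*} [Group Γ] {d : ℕ → ℕ}
    (φ : ∀ n, Γ → Matrix.unitaryGroup (Fin (d n)) ℂ) : Prop :=
  ∀ g : Γ, g ≠ 1 → 0 < liminf (fun n => ENNReal.ofReal (schattenDist p (φ n g) 1)) atTop

/-- `Γ` is approximated by finite-dimensional unitary groups with respect to the Schatten
`p`-norm. -/
def IsSchattenApproximated (p : ℝ≥0∞) (Γ : Type*) [Group Γ] : Prop :=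
  ∃ (d : ℕ → ℕ) (φ : ∀ n, Γ → Matrix.unitaryGroup (Fin (d n)) ℂ),
    IsAsymptoticHom p φ ∧ AsymptoticallySeparates p φ

end

/-!
Let `φ n` approximate `Γ` in `‖·‖_p` and `ψ n` approximate `Γ ⧸ N` in `‖·‖_q`, and let `π` be the
quotient map. The block sums `φ n ⊕ (ψ n ∘ π)` approximate `Γ` in `‖·‖_q`: since `‖·‖_q ≤ ‖·‖_p`,
they are asymptotically multiplicative, and elements outside `N` are separated by the second block.
An element of `N` has some finite order `k`, and for a unitary `u` the factorization
`u ^ k - 1 = (u - 1) * (k + ∑ i < k, (u ^ i - 1))` gives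
`k * (1 - k * ‖u - 1‖_∞) * ‖u - 1‖_p ≤ ‖u ^ k - 1‖_p`. For `u = φ n g` the right side tends to `0`
while `‖u - 1‖_p` stays away from `0`, so `‖u - 1‖_∞ ≥ 1 / (2 * k)` eventually, and the first block
separates `g` in operator norm, hence in `‖·‖_q`.

The Schatten norms are controlled through the variational formula that `‖A‖_p` is the
maximum over contractions `X` and `Y` of the `ℓ^p` norm of the diagonal of `X * A * Y`. The upper
bound is Jensen's inequality for the doubly substochastic weights `(|X i k| ^ 2 + |Y k i| ^ 2) / 2`
when `A` is diagonal, and a singular value decomposition reduces to that case and attains equality.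

A countable residually finite group embeds asymptotically into finite groups, and permutation
matrices of distinct permutations are at distance at least `1` in every Schatten norm.
-/

section LpNorm

open WithLp

variable {ι κ E F : Type*} [Fintype ι] [Fintype κ] [SeminormedAddCommGroup E]
  [SeminormedAddCommGroup F] {p q : ℝ≥0∞}

theorem toReal_pos_of_one_le [hp : Fact (1 ≤ p)] (hp_top : p ≠ ∞) : 0 < p.toReal :=
  ENNReal.toReal_pos (zero_lt_one.trans_le hp.out).ne' hp_top

theorem norm_toLp_rpow_eq_sum [Fact (1 ≤ p)] (hp_top : p ≠ ∞) (x : ι → E) :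
    ‖toLp p x‖ ^ p.toReal = ∑ i, ‖x i‖ ^ p.toReal := by
  have hp_pos := toReal_pos_of_one_le hp_top
  rw [PiLp.norm_eq_sum hp_pos, one_div, Real.rpow_inv_rpow (by positivity) hp_pos.ne']

theorem norm_toLp_antitone [hp : Fact (1 ≤ p)] (hpq : p ≤ q) (x : ι → E) :
    ‖toLp q x‖ ≤ ‖toLp p x‖ := by
  have : Fact (1 ≤ q) := ⟨hp.out.trans hpq⟩
  have entry_le (i : ι) : ‖x i‖ ≤ ‖toLp p x‖ := PiLp.norm_apply_le (toLp p x) i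
  rcases eq_or_ne q ∞ with rfl | hq_top
  · rw [PiLp.norm_toLp]
    exact (pi_norm_le_iff_of_nonneg (norm_nonneg _)).2 entry_le
  have hp_top := ne_top_of_le_ne_top hq_top hpq
  have hp_pos := toReal_pos_of_one_le hp_top
  have hr : 0 ≤ q.toReal - p.toReal := sub_nonneg.2 (ENNReal.toReal_mono hq_top hpq)
  refine (Real.rpow_le_rpow_iff (norm_nonneg _) (norm_nonneg _)
    (toReal_pos_of_one_le hq_top)).1 ?_
  calc ‖toLp q x‖ ^ q.toReal = ∑ i, ‖x i‖ ^ p.toReal * ‖x i‖ ^ (q.toReal - p.toReal) := by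
        simp_rw [norm_toLp_rpow_eq_sum hq_top,
          ← Real.rpow_add_of_nonneg (norm_nonneg _) hp_pos.le hr, add_sub_cancel]
    _ ≤ ∑ i, ‖x i‖ ^ p.toReal * ‖toLp p x‖ ^ (q.toReal - p.toReal) := by
        gcongr with i
        exact entry_le i
    _ = ‖toLp p x‖ ^ q.toReal := by
        rw [← Finset.sum_mul, ← norm_toLp_rpow_eq_sum hp_top,
          ← Real.rpow_add_of_nonneg (norm_nonneg _) hp_pos.le hr, add_sub_cancel]

theorem norm_toLp_congr [Fact (1 ≤ p)] {x : ι → E} {y : ι → F} (h : ∀ i, ‖x i‖ = ‖y i‖) :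
    ‖toLp p x‖ = ‖toLp p y‖ := by
  rcases eq_or_ne p ∞ with rfl | hp_top
  · simp only [PiLp.norm_eq_ciSup, h]
  · simp only [PiLp.norm_eq_sum (toReal_pos_of_one_le hp_top), h]

theorem rpow_sum_mul_le_of_sum_le_one {w f : ι → ℝ} (hw : ∀ i, 0 ≤ w i) (hw_sum : ∑ i, w i ≤ 1)
    (hf : ∀ i, 0 ≤ f i) {r : ℝ} (hr : 1 ≤ r) :
    (∑ i, w i * f i) ^ r ≤ ∑ i, w i * f i ^ r := by
  have hsum : 0 ≤ ∑ i, w i * f i ^ r :=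
    Finset.sum_nonneg fun i _ => mul_nonneg (hw i) (Real.rpow_nonneg (hf i) r)
  rw [← Real.le_rpow_inv_iff_of_pos (Finset.sum_nonneg fun i _ => mul_nonneg (hw i) (hf i)) hsum
    (one_pos.trans_le hr)]
  refine (Real.inner_le_weight_mul_Lp_of_nonneg _ hr w f hw hf).trans ?_
  exact mul_le_of_le_one_left (Real.rpow_nonneg hsum _)
    (Real.rpow_le_one (Finset.sum_nonneg fun i _ => hw i) hw_sum
      (sub_nonneg.2 (inv_le_one_of_one_le₀ hr)))

theorem norm_toLp_le_of_doublySubstochastic [hp : Fact (1 ≤ p)] {w : ι → κ → ℝ}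
    (hw : ∀ i k, 0 ≤ w i k) (hrow : ∀ i, ∑ k, w i k ≤ 1) (hcol : ∀ k, ∑ i, w i k ≤ 1)
    {x : ι → E} {y : κ → F} (hxy : ∀ i, ‖x i‖ ≤ ∑ k, w i k * ‖y k‖) :
    ‖toLp p x‖ ≤ ‖toLp p y‖ := by
  rcases eq_or_ne p ∞ with rfl | hp_top
  · simp only [PiLp.norm_toLp]
    refine (pi_norm_le_iff_of_nonneg (norm_nonneg y)).2 fun i => ?_
    calc ‖x i‖ ≤ ∑ k, w i k * ‖y k‖ := hxy i
      _ ≤ ∑ k, w i k * ‖y‖ := by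
          gcongr with k
          · exact hw i k
          · exact norm_le_pi_norm y k
      _ = (∑ k, w i k) * ‖y‖ := by rw [Finset.sum_mul]
      _ ≤ ‖y‖ := mul_le_of_le_one_left (norm_nonneg y) (hrow i)
  have hr : 1 ≤ p.toReal := by simpa using ENNReal.toReal_mono hp_top hp.out
  refine (Real.rpow_le_rpow_iff (norm_nonneg _) (norm_nonneg _) (one_pos.trans_le hr)).1 ?_
  rw [norm_toLp_rpow_eq_sum hp_top, norm_toLp_rpow_eq_sum hp_top]
  calc ∑ i, ‖x i‖ ^ p.toReal ≤ ∑ i, (∑ k, w i k * ‖y k‖) ^ p.toReal := by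
        gcongr with i
        exact hxy i
    _ ≤ ∑ i, ∑ k, w i k * ‖y k‖ ^ p.toReal := by
        gcongr with i
        exact rpow_sum_mul_le_of_sum_le_one (hw i) (hrow i) (fun k => norm_nonneg (y k)) hr
    _ = ∑ k, (∑ i, w i k) * ‖y k‖ ^ p.toReal := by
        rw [Finset.sum_comm]
        simp only [Finset.sum_mul]
    _ ≤ ∑ k, ‖y k‖ ^ p.toReal := by
        gcongr with k
        exact mul_le_of_le_one_left (by positivity) (hcol k)

end LpNorm

section Contraction

open Matrix WithLp
open scoped Matrix.Norms.L2Operator ComplexOrder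

variable {𝕜 m n : Type*} [RCLike 𝕜] [Fintype m] [Fintype n] [DecidableEq n]

theorem sum_sq_norm_col_le (X : Matrix m n 𝕜) (k : n) : ∑ i, ‖X i k‖ ^ 2 ≤ ‖X‖ ^ 2 := by
  have h := X.l2_opNorm_mulVec (EuclideanSpace.single k 1)
  rw [PiLp.norm_single, norm_one, mul_one] at h
  simpa [EuclideanSpace.norm_sq_eq] using pow_le_pow_left₀ (norm_nonneg _) h 2

theorem l2_opNorm_le_one_of_conjTranspose_mul_self_eq_diagonal {X : Matrix m n 𝕜} {t : n → 𝕜}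
    (h : Xᴴ * X = diagonal t) (ht : ∀ i, ‖t i‖ ≤ 1) : ‖X‖ ≤ 1 := by
  have hX : ‖X‖ * ‖X‖ ≤ 1 := by
    rw [← l2_opNorm_conjTranspose_mul_self, h, l2_opNorm_diagonal]
    exact (pi_norm_le_iff_of_nonneg zero_le_one).2 ht
  exact abs_le_one_iff_mul_self_le_one.2 hX |> (le_abs_self _).trans

theorem l2_opNorm_le_one_of_conjTranspose_mul_self_eq_one {X : Matrix m n 𝕜} (h : Xᴴ * X = 1) :
    ‖X‖ ≤ 1 :=
  l2_opNorm_le_one_of_conjTranspose_mul_self_eq_diagonal (h.trans diagonal_one.symm)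
    fun _ => norm_one.le

-- The factor is `M * (diagonal s)⁻¹`, where the convention `0⁻¹ = 0` makes it a partial isometry
-- that vanishes on the kernel of `M`.
theorem exists_contraction_mul_diagonal_eq {M : Matrix m n 𝕜} {s : n → 𝕜} (hs : IsSelfAdjoint s)
    (h : Mᴴ * M = diagonal s * diagonal s) :
    ∃ U : Matrix m n 𝕜, ‖U‖ ≤ 1 ∧ U * diagonal s = M ∧ Uᴴ * M = diagonal s := by
  set D := diagonal s
  set E := diagonal s⁻¹
  have hD : Dᴴ = D := by rw [diagonal_conjTranspose, hs.star_eq]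
  have hE : Eᴴ = E :=
    (diagonal_conjTranspose _).trans (congrArg diagonal (funext fun i => (hs.apply i).inv₀.star_eq))
  have hEDD : E * (D * D) = D := by
    simp only [D, E, diagonal_mul_diagonal, Pi.inv_apply, inv_mul_mul_self, ← mul_assoc]
  have hUM : (M * E)ᴴ * M = D := by
    rw [conjTranspose_mul, hE, Matrix.mul_assoc, h, hEDD]
  refine ⟨M * E, ?_, ?_, hUM⟩
  · refine l2_opNorm_le_one_of_conjTranspose_mul_self_eq_diagonal (t := s * s⁻¹) ?_ fun i => ?_
    · rw [← Matrix.mul_assoc, hUM, diagonal_mul_diagonal]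
      rfl
    · rcases eq_or_ne (s i) 0 with hi | hi <;> simp [hi]
  · have range_orthogonal : (M * E * D - M)ᴴ * M = 0 := by
      rw [conjTranspose_sub, Matrix.sub_mul, conjTranspose_mul, Matrix.mul_assoc, hUM, hD, h,
        sub_self]
    refine sub_eq_zero.1 (conjTranspose_mul_self_eq_zero.1 ?_)
    rw [Matrix.mul_sub, range_orthogonal, sub_zero]
    calc (M * E * D - M)ᴴ * (M * E * D) = (M * E * D - M)ᴴ * M * (E * D) := by
          simp only [Matrix.mul_assoc]
      _ = 0 := by rw [range_orthogonal, Matrix.zero_mul]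

theorem sum_sq_norm_row_le (X : Matrix m n 𝕜) (i : m) : ∑ k, ‖X i k‖ ^ 2 ≤ ‖X‖ ^ 2 := by
  classical
  simpa [l2_opNorm_conjTranspose] using sum_sq_norm_col_le Xᴴ i

theorem norm_entry_le_l2_opNorm (X : Matrix m n 𝕜) (i : m) (k : n) : ‖X i k‖ ≤ ‖X‖ :=
  le_of_sq_le_sq ((Finset.single_le_sum (f := fun k => ‖X i k‖ ^ 2) (fun _ _ => sq_nonneg _)
    (Finset.mem_univ k)).trans (sum_sq_norm_row_le X i)) (norm_nonneg _)

variable [DecidableEq m]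

theorem l2_opNorm_one_submatrix_le_one {f : n → m} (hf : Function.Injective f) :
    ‖(1 : Matrix m m 𝕜).submatrix id f‖ ≤ 1 := by
  refine l2_opNorm_le_one_of_conjTranspose_mul_self_eq_one ?_
  rw [conjTranspose_submatrix, conjTranspose_one, ← submatrix_mul _ _ f id f Function.bijective_id,
    Matrix.mul_one, submatrix_one f hf]

theorem l2_opNorm_unitary_le_one (u : unitaryGroup n 𝕜) : ‖(u : Matrix n n 𝕜)‖ ≤ 1 :=
  l2_opNorm_le_one_of_conjTranspose_mul_self_eq_one (Unitary.coe_star_mul_self u)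

theorem l2_opNorm_mul_le_one {l : Type*} [Fintype l] {X : Matrix l m 𝕜}
    {Y : Matrix m n 𝕜} (hX : ‖X‖ ≤ 1) (hY : ‖Y‖ ≤ 1) : ‖X * Y‖ ≤ 1 := by
  classical
  exact (l2_opNorm_mul X Y).trans (mul_le_one₀ hX (norm_nonneg Y) hY)

-- `|X i k * Y k i|` is at most the mean of `|X i k| ^ 2` and `|Y k i| ^ 2`.
theorem norm_toLp_diag_mul_diagonal_mul_le {p : ℝ≥0∞} [Fact (1 ≤ p)] {X : Matrix m n 𝕜}
    {Y : Matrix n m 𝕜} (hX : ‖X‖ ≤ 1) (hY : ‖Y‖ ≤ 1) (s : n → 𝕜) :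
    ‖toLp p (diag (X * diagonal s * Y))‖ ≤ ‖toLp p s‖ := by
  have hX_sq : ‖X‖ ^ 2 ≤ 1 := pow_le_one₀ (norm_nonneg _) hX
  have hY_sq : ‖Y‖ ^ 2 ≤ 1 := pow_le_one₀ (norm_nonneg _) hY
  refine norm_toLp_le_of_doublySubstochastic
    (w := fun i k => (‖X i k‖ ^ 2 + ‖Y k i‖ ^ 2) / 2) (fun i k => by positivity)
    (fun i => ?_) (fun k => ?_) fun i => ?_
  · rw [← Finset.sum_div, Finset.sum_add_distrib]
    linarith [sum_sq_norm_row_le X i, sum_sq_norm_col_le Y i]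
  · rw [← Finset.sum_div, Finset.sum_add_distrib]
    linarith [sum_sq_norm_col_le X k, sum_sq_norm_row_le Y k]
  · rw [diag_apply, mul_apply]
    refine norm_sum_le_of_le _ fun k _ => ?_
    calc ‖(X * diagonal s) i k * Y k i‖ = ‖X i k‖ * ‖Y k i‖ * ‖s k‖ := by
          rw [mul_diagonal, norm_mul, norm_mul, mul_right_comm]
      _ ≤ (‖X i k‖ ^ 2 + ‖Y k i‖ ^ 2) / 2 * ‖s k‖ := by
          gcongr
          linarith [two_mul_le_add_sq ‖X i k‖ ‖Y k i‖]

end Contraction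

section SchattenNorm

open Matrix WithLp
open scoped MatrixOrder ComplexOrder Matrix.Norms.L2Operator

theorem trace_rpow_eq_sum_eigenvalues {n : Type*} [Fintype n] [DecidableEq n] {P : Matrix n n ℂ}
    (hP : P.PosSemidef) (r : ℝ) :
    (P ^ r).trace = ∑ i, ((hP.isHermitian.eigenvalues i ^ r : ℝ) : ℂ) := by
  rw [CFC.rpow_eq_cfc_real hP.nonneg, hP.isHermitian.cfc_eq, Matrix.IsHermitian.cfc,
    Unitary.conjStarAlgAut_apply, Matrix.trace_mul_comm, ← Matrix.mul_assoc,
    Unitary.coe_star_mul_self, Matrix.one_mul, Matrix.trace_diagonal]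
  rfl

variable {p q : ℝ≥0∞} {d : ℕ}

theorem posSemidef_abs (A : Matrix (Fin d) (Fin d) ℂ) : (CFC.abs A).PosSemidef :=
  nonneg_iff_posSemidef.1 (CFC.abs_nonneg A)

theorem schattenNorm_eq_norm_toLp_eigenvalues [Fact (1 ≤ p)] (A : Matrix (Fin d) (Fin d) ℂ) :
    schattenNorm p A = ‖toLp p (posSemidef_abs A).isHermitian.eigenvalues‖ := by
  have hA := posSemidef_abs A
  rcases eq_or_ne p ∞ with rfl | hp_top
  · calc schattenNorm ∞ A = ‖CFC.abs A‖ := by rw [schattenNorm, if_pos rfl, CFC.norm_abs]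
      _ = ‖toLp ∞ hA.isHermitian.eigenvalues‖ := by
        conv_lhs => rw [hA.isHermitian.spectral_theorem, Unitary.conjStarAlgAut_apply,
          ← Unitary.coe_star, CStarRing.norm_mul_coe_unitary, CStarRing.norm_coe_unitary_mul,
          l2_opNorm_diagonal]
        simp [PiLp.norm_toLp, Pi.norm_def]
  · rw [schattenNorm, if_neg hp_top, trace_rpow_eq_sum_eigenvalues hA,
      PiLp.norm_eq_sum (toReal_pos_of_one_le hp_top), ← Complex.ofReal_sum, Complex.ofReal_re]
    simp [abs_of_nonneg, hA.eigenvalues_nonneg]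

-- Asking only for contractions spares extending the partial isometry of the polar decomposition
-- to a unitary.
theorem exists_singularValues (A : Matrix (Fin d) (Fin d) ℂ) :
    ∃ (X Y : Matrix (Fin d) (Fin d) ℂ) (s : Fin d → ℂ), ‖X‖ ≤ 1 ∧ ‖Y‖ ≤ 1 ∧
      X * diagonal s * Y = A ∧ Xᴴ * A * Yᴴ = diagonal s ∧
      ∀ (p : ℝ≥0∞) [Fact (1 ≤ p)], schattenNorm p A = ‖toLp p s‖ := by
  have hA := (posSemidef_abs A).isHermitian
  set W := hA.eigenvectorUnitary
  set s : Fin d → ℂ := RCLike.ofReal ∘ hA.eigenvalues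
  have gram : (A * (W : Matrix (Fin d) (Fin d) ℂ))ᴴ * (A * (W : Matrix (Fin d) (Fin d) ℂ)) =
      diagonal s * diagonal s :=
    calc (A * (W : Matrix (Fin d) (Fin d) ℂ))ᴴ * (A * (W : Matrix (Fin d) (Fin d) ℂ))
        = Unitary.conjStarAlgAut ℂ _ (star W) (star A * A) := by
          simp only [Unitary.conjStarAlgAut_star_apply, star_eq_conjTranspose, conjTranspose_mul,
            Matrix.mul_assoc]
      _ = diagonal s * diagonal s := by
          rw [← CFC.abs_mul_abs A, map_mul, hA.conjStarAlgAut_star_eigenvectorUnitary]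
  have hs : IsSelfAdjoint s := funext fun i => RCLike.conj_ofReal _
  obtain ⟨U, hU, hUD, hUA⟩ := exists_contraction_mul_diagonal_eq hs gram
  refine ⟨U, (star W : unitaryGroup (Fin d) ℂ), s, hU, l2_opNorm_unitary_le_one (star W), ?_, ?_,
    fun p _ => ?_⟩
  · rw [hUD, Matrix.mul_assoc, Unitary.coe_mul_star_self, Matrix.mul_one]
  · rw [Unitary.coe_star, star_eq_conjTranspose, conjTranspose_conjTranspose, Matrix.mul_assoc, hUA]
  · rw [schattenNorm_eq_norm_toLp_eigenvalues]
    exact norm_toLp_congr fun i => (RCLike.norm_ofReal _).symm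

theorem norm_toLp_diag_mul_mul_le_schattenNorm {m : Type*} [Fintype m] [DecidableEq m]
    [Fact (1 ≤ p)] {X : Matrix m (Fin d) ℂ} {Y : Matrix (Fin d) m ℂ} (hX : ‖X‖ ≤ 1) (hY : ‖Y‖ ≤ 1)
    (A : Matrix (Fin d) (Fin d) ℂ) : ‖toLp p (diag (X * A * Y))‖ ≤ schattenNorm p A := by
  obtain ⟨U, V, s, hU, hV, rfl, -, h⟩ := exists_singularValues A
  rw [h]
  simpa only [Matrix.mul_assoc] using norm_toLp_diag_mul_diagonal_mul_le
    (l2_opNorm_mul_le_one hX hU) (l2_opNorm_mul_le_one hV hY) s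

theorem exists_contractions_schattenNorm_eq (A : Matrix (Fin d) (Fin d) ℂ) :
    ∃ X Y : Matrix (Fin d) (Fin d) ℂ, ‖X‖ ≤ 1 ∧ ‖Y‖ ≤ 1 ∧
      ∀ (p : ℝ≥0∞) [Fact (1 ≤ p)], schattenNorm p A = ‖toLp p (diag (X * A * Y))‖ := by
  obtain ⟨U, V, s, hU, hV, -, hs, h⟩ := exists_singularValues A
  refine ⟨Uᴴ, Vᴴ, by rwa [l2_opNorm_conjTranspose], by rwa [l2_opNorm_conjTranspose], fun p _ => ?_⟩
  rw [h, hs, diag_diagonal]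

theorem schattenNorm_mul_mul_le [Fact (1 ≤ p)] {m n : ℕ} {X : Matrix (Fin m) (Fin n) ℂ}
    {Y : Matrix (Fin n) (Fin m) ℂ} (hX : ‖X‖ ≤ 1) (hY : ‖Y‖ ≤ 1)
    (A : Matrix (Fin n) (Fin n) ℂ) : schattenNorm p (X * A * Y) ≤ schattenNorm p A := by
  obtain ⟨U, V, hU, hV, h⟩ := exists_contractions_schattenNorm_eq (X * A * Y)
  rw [h]
  simpa only [Matrix.mul_assoc] using norm_toLp_diag_mul_mul_le_schattenNorm
    (l2_opNorm_mul_le_one hU hX) (l2_opNorm_mul_le_one hY hV) A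

theorem schattenNorm_zero [Fact (1 ≤ p)] : schattenNorm p (0 : Matrix (Fin d) (Fin d) ℂ) = 0 := by
  obtain ⟨X, Y, -, -, h⟩ := exists_contractions_schattenNorm_eq (0 : Matrix (Fin d) (Fin d) ℂ)
  rw [h, Matrix.mul_zero, Matrix.zero_mul, diag_zero, toLp_zero, norm_zero]

theorem schattenNorm_add_le [Fact (1 ≤ p)] (A B : Matrix (Fin d) (Fin d) ℂ) :
    schattenNorm p (A + B) ≤ schattenNorm p A + schattenNorm p B := by
  obtain ⟨X, Y, hX, hY, h⟩ := exists_contractions_schattenNorm_eq (A + B)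
  calc schattenNorm p (A + B) = ‖toLp p (diag (X * A * Y)) + toLp p (diag (X * B * Y))‖ := by
        rw [h, Matrix.mul_add, Matrix.add_mul, diag_add, toLp_add]
    _ ≤ ‖toLp p (diag (X * A * Y))‖ + ‖toLp p (diag (X * B * Y))‖ := norm_add_le _ _
    _ ≤ schattenNorm p A + schattenNorm p B :=
        add_le_add (norm_toLp_diag_mul_mul_le_schattenNorm hX hY A)
          (norm_toLp_diag_mul_mul_le_schattenNorm hX hY B)

theorem schattenNorm_smul_le [Fact (1 ≤ p)] (c : ℂ) (A : Matrix (Fin d) (Fin d) ℂ) :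
    schattenNorm p (c • A) ≤ ‖c‖ * schattenNorm p A := by
  obtain ⟨X, Y, hX, hY, h⟩ := exists_contractions_schattenNorm_eq (c • A)
  calc schattenNorm p (c • A) = ‖c‖ * ‖toLp p (diag (X * A * Y))‖ := by
        rw [h, Matrix.mul_smul, Matrix.smul_mul, diag_smul, toLp_smul, norm_smul]
    _ ≤ ‖c‖ * schattenNorm p A := by
        gcongr
        exact norm_toLp_diag_mul_mul_le_schattenNorm hX hY A

variable (p d) in
/-- The Schatten `p`-norm as a seminorm on the space of matrices, for `1 ≤ p`. -/
noncomputable def schattenSeminorm [Fact (1 ≤ p)] : Seminorm ℂ (Matrix (Fin d) (Fin d) ℂ) :=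
  Seminorm.ofSMulLE (schattenNorm p) schattenNorm_zero schattenNorm_add_le schattenNorm_smul_le

theorem schattenNorm_mul_le [Fact (1 ≤ p)] (A B : Matrix (Fin d) (Fin d) ℂ) :
    schattenNorm p (A * B) ≤ schattenNorm p A * ‖B‖ := by
  set B₁ := NormedSpace.normalize B
  have hB₁ : ‖B₁‖ ≤ 1 := by
    rcases eq_or_ne B 0 with rfl | hB
    · simp [B₁]
    · exact (NormedSpace.norm_normalize hB).le
  calc schattenNorm p (A * B) = schattenSeminorm p d ((‖B‖ : ℂ) • (1 * A * B₁)) := by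
        rw [Matrix.one_mul, ← Matrix.mul_smul, Complex.coe_smul, NormedSpace.norm_smul_normalize]
        rfl
    _ = ‖B‖ * schattenNorm p (1 * A * B₁) := by
        rw [map_smul_eq_mul, Complex.norm_real, norm_norm]
        rfl
    _ ≤ ‖B‖ * schattenNorm p A := by
        gcongr
        exact schattenNorm_mul_mul_le (l2_opNorm_unitary_le_one 1) hB₁ A
    _ = schattenNorm p A * ‖B‖ := mul_comm _ _

theorem schattenNorm_antitone [Fact (1 ≤ p)] (hpq : p ≤ q) (A : Matrix (Fin d) (Fin d) ℂ) :
    schattenNorm q A ≤ schattenNorm p A := by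
  have : Fact (1 ≤ q) := ⟨le_trans Fact.out hpq⟩
  rw [schattenNorm_eq_norm_toLp_eigenvalues, schattenNorm_eq_norm_toLp_eigenvalues]
  exact norm_toLp_antitone hpq _

theorem schattenNorm_submatrix_le [Fact (1 ≤ p)] {m n : ℕ} {f : Fin m → Fin n}
    (hf : Function.Injective f) (A : Matrix (Fin n) (Fin n) ℂ) :
    schattenNorm p (A.submatrix f f) ≤ schattenNorm p A := by
  set Y : Matrix (Fin n) (Fin m) ℂ := (1 : Matrix (Fin n) (Fin n) ℂ).submatrix id f
  have hY : ‖Y‖ ≤ 1 := l2_opNorm_one_submatrix_le_one hf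
  calc schattenNorm p (A.submatrix f f) = schattenNorm p (Yᴴ * A * Y) := by
        congr 1
        ext i j
        simp [Y, mul_apply, one_apply]
    _ ≤ schattenNorm p A := schattenNorm_mul_mul_le (by rwa [l2_opNorm_conjTranspose]) hY A

theorem schattenNorm_reindex_fromBlocks_le [Fact (1 ≤ p)] {k m n : ℕ} (e : Fin m ⊕ Fin n ≃ Fin k)
    (A : Matrix (Fin m) (Fin m) ℂ) (B : Matrix (Fin n) (Fin n) ℂ) :
    schattenNorm p (reindex e e (fromBlocks A 0 0 B)) ≤ schattenNorm p A + schattenNorm p B := by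
  set X : Matrix (Fin k) (Fin m) ℂ := (1 : Matrix (Fin k) (Fin k) ℂ).submatrix id (e ∘ Sum.inl)
  set Y : Matrix (Fin k) (Fin n) ℂ := (1 : Matrix (Fin k) (Fin k) ℂ).submatrix id (e ∘ Sum.inr)
  have hX : ‖X‖ ≤ 1 := l2_opNorm_one_submatrix_le_one (e.injective.comp Sum.inl_injective)
  have hY : ‖Y‖ ≤ 1 := l2_opNorm_one_submatrix_le_one (e.injective.comp Sum.inr_injective)
  have decomposition : reindex e e (fromBlocks A 0 0 B) = X * A * Xᴴ + Y * B * Yᴴ := by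
    ext i j
    obtain ⟨i, rfl⟩ := e.surjective i
    obtain ⟨j, rfl⟩ := e.surjective j
    rcases i with i | i <;> rcases j with j | j <;> simp [X, Y, mul_apply, one_apply]
  rw [decomposition]
  exact (schattenNorm_add_le _ _).trans
    (add_le_add (schattenNorm_mul_mul_le hX (by rwa [l2_opNorm_conjTranspose]) A)
      (schattenNorm_mul_mul_le hY (by rwa [l2_opNorm_conjTranspose]) B))

end SchattenNorm

section SchattenDist

open Matrix
open scoped Matrix.Norms.L2Operator

variable {p q : ℝ≥0∞} [Fact (1 ≤ p)] {d : ℕ}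

theorem schattenDist_nonneg (u v : unitaryGroup (Fin d) ℂ) : 0 ≤ schattenDist p u v :=
  apply_nonneg (schattenSeminorm p d) _

theorem schattenDist_self (u : unitaryGroup (Fin d) ℂ) : schattenDist p u u = 0 := by
  rw [schattenDist, sub_self, schattenNorm_zero]

theorem schattenDist_comm (u v : unitaryGroup (Fin d) ℂ) :
    schattenDist p u v = schattenDist p v u :=
  map_sub_rev (schattenSeminorm p d) _ _

theorem schattenDist_triangle (u v w : unitaryGroup (Fin d) ℂ) :
    schattenDist p u w ≤ schattenDist p u v + schattenDist p v w :=
  le_map_sub_add_map_sub (schattenSeminorm p d) _ _ _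

theorem schattenDist_antitone (hpq : p ≤ q) (u v : unitaryGroup (Fin d) ℂ) :
    schattenDist q u v ≤ schattenDist p u v :=
  schattenNorm_antitone hpq _

theorem schattenDist_mul_mul_le (w u v x : unitaryGroup (Fin d) ℂ) :
    schattenDist p (w * u * x) (w * v * x) ≤ schattenDist p u v := by
  have h := schattenNorm_mul_mul_le (p := p) (l2_opNorm_unitary_le_one w)
    (l2_opNorm_unitary_le_one x) ((u : Matrix (Fin d) (Fin d) ℂ) - (v : Matrix (Fin d) (Fin d) ℂ))
  rwa [Matrix.mul_sub, Matrix.sub_mul] at h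

theorem schattenDist_mul_left (w u v : unitaryGroup (Fin d) ℂ) :
    schattenDist p (w * u) (w * v) = schattenDist p u v :=
  le_antisymm (by simpa only [mul_one] using schattenDist_mul_mul_le w u v 1)
    (by simpa only [mul_one, inv_mul_cancel_left] using
      schattenDist_mul_mul_le w⁻¹ (w * u) (w * v) 1)

theorem schattenDist_mul_right (w u v : unitaryGroup (Fin d) ℂ) :
    schattenDist p (u * w) (v * w) = schattenDist p u v :=
  le_antisymm (by simpa only [one_mul] using schattenDist_mul_mul_le 1 u v w)
    (by simpa only [one_mul, mul_inv_cancel_right] using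
      schattenDist_mul_mul_le 1 (u * w) (v * w) w⁻¹)

theorem schattenDist_pow_one_le (u : unitaryGroup (Fin d) ℂ) (k : ℕ) :
    schattenDist p (u ^ k) 1 ≤ k * schattenDist p u 1 := by
  induction k with
  | zero => simp [schattenDist_self]
  | succ k ih =>
    calc schattenDist p (u ^ (k + 1)) 1
        ≤ schattenDist p (u ^ k * u) (1 * u) + schattenDist p u 1 := by
          rw [pow_succ, one_mul]
          exact schattenDist_triangle _ _ _
      _ ≤ k * schattenDist p u 1 + schattenDist p u 1 := by
          rw [schattenDist_mul_right]
          gcongr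
      _ = (k + 1 : ℕ) * schattenDist p u 1 := by push_cast; ring

theorem norm_sum_pow_sub_one_le (u : unitaryGroup (Fin d) ℂ) (k : ℕ) :
    ‖∑ i ∈ Finset.range k, ((u : Matrix (Fin d) (Fin d) ℂ) ^ i - 1)‖ ≤
      k * (k * schattenDist ∞ u 1) := by
  have pow_le (i : ℕ) (hi : i ∈ Finset.range k) :
      ‖(u : Matrix (Fin d) (Fin d) ℂ) ^ i - 1‖ ≤ k * schattenDist ∞ u 1 :=
    calc ‖(u : Matrix (Fin d) (Fin d) ℂ) ^ i - 1‖ = schattenDist ∞ (u ^ i) 1 := by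
          simp [schattenDist, schattenNorm]
      _ ≤ i * schattenDist ∞ u 1 := schattenDist_pow_one_le u i
      _ ≤ k * schattenDist ∞ u 1 := by
          gcongr
          · exact schattenDist_nonneg _ _
          · exact (Finset.mem_range.1 hi).le
  simpa using norm_sum_le_of_le _ pow_le

theorem mul_schattenDist_le_schattenDist_pow (u : unitaryGroup (Fin d) ℂ) (k : ℕ) :
    k * (1 - k * schattenDist ∞ u 1) * schattenDist p u 1 ≤ schattenDist p (u ^ k) 1 := by
  set U := (u : Matrix (Fin d) (Fin d) ℂ)
  set S := ∑ i ∈ Finset.range k, (U ^ i - 1)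
  have telescope : (k : ℂ) • (U - 1) = (U ^ k - 1) - (U - 1) * S := by
    simp only [S]
    rw [Finset.sum_sub_distrib, mul_sub, mul_geom_sum, Finset.sum_const, Finset.card_range,
      sub_sub_cancel, mul_smul_comm, mul_one, Nat.cast_smul_eq_nsmul]
  have hpow : schattenDist p (u ^ k) 1 = schattenSeminorm p d (U ^ k - 1) := rfl
  have bound : k * schattenDist p u 1 ≤
      schattenDist p (u ^ k) 1 + schattenDist p u 1 * (k * (k * schattenDist ∞ u 1)) :=
    calc k * schattenDist p u 1 = schattenSeminorm p d ((k : ℂ) • (U - 1)) := by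
          rw [map_smul_eq_mul, Complex.norm_natCast]
          rfl
      _ ≤ schattenSeminorm p d (U ^ k - 1) + schattenNorm p ((U - 1) * S) := by
          rw [telescope]
          exact map_sub_le_add _ _ _
      _ ≤ schattenSeminorm p d (U ^ k - 1) + schattenDist p u 1 * ‖S‖ := by
          gcongr
          exact schattenNorm_mul_le _ _
      _ ≤ schattenDist p (u ^ k) 1 + schattenDist p u 1 * (k * (k * schattenDist ∞ u 1)) := by
          gcongr
          · exact hpow.ge
          · exact schattenDist_nonneg _ _
          · exact norm_sum_pow_sub_one_le u k
  linarith

end SchattenDist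

section BlockSum

open Matrix

variable {p : ℝ≥0∞} {m n : ℕ}

variable (m n) in
/-- The block-diagonal direct sum `u ⊕ v` of unitaries, as a group homomorphism. The two blocks are
reindexed along `Fin m ⊕ Fin n ≃ Fin (m + n)`. -/
def unitaryBlockSum : unitaryGroup (Fin m) ℂ × unitaryGroup (Fin n) ℂ →*
    unitaryGroup (Fin (m + n)) ℂ :=
  MonoidHom.mk' (fun w => ⟨reindex finSumFinEquiv finSumFinEquiv
      (fromBlocks (w.1 : Matrix (Fin m) (Fin m) ℂ) 0 0 (w.2 : Matrix (Fin n) (Fin n) ℂ)), by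
        rw [mem_unitaryGroup_iff, star_eq_conjTranspose, conjTranspose_reindex,
          fromBlocks_conjTranspose, reindex_apply, reindex_apply, submatrix_mul_equiv,
          fromBlocks_multiply]
        simp [← star_eq_conjTranspose]⟩)
    fun w z => by
      ext1
      simp [submatrix_mul_equiv, fromBlocks_multiply]

theorem schattenDist_unitaryBlockSum_eq (w z : unitaryGroup (Fin m) ℂ × unitaryGroup (Fin n) ℂ) :
    schattenDist p (unitaryBlockSum m n w) (unitaryBlockSum m n z) =
      schattenNorm p (reindex finSumFinEquiv finSumFinEquiv (fromBlocks
        ((w.1 : Matrix (Fin m) (Fin m) ℂ) - (z.1 : Matrix (Fin m) (Fin m) ℂ)) 0 0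
        ((w.2 : Matrix (Fin n) (Fin n) ℂ) - (z.2 : Matrix (Fin n) (Fin n) ℂ)))) := by
  rw [schattenDist]
  congr 1
  ext i j
  obtain ⟨i, rfl⟩ := finSumFinEquiv.surjective i
  obtain ⟨j, rfl⟩ := finSumFinEquiv.surjective j
  rcases i with i | i <;> rcases j with j | j <;> simp [unitaryBlockSum]

variable [Fact (1 ≤ p)]

theorem schattenDist_unitaryBlockSum_le (w z : unitaryGroup (Fin m) ℂ × unitaryGroup (Fin n) ℂ) :
    schattenDist p (unitaryBlockSum m n w) (unitaryBlockSum m n z) ≤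
      schattenDist p w.1 z.1 + schattenDist p w.2 z.2 := by
  rw [schattenDist_unitaryBlockSum_eq]
  exact schattenNorm_reindex_fromBlocks_le _ _ _

theorem schattenDist_fst_le_unitaryBlockSum
    (w z : unitaryGroup (Fin m) ℂ × unitaryGroup (Fin n) ℂ) :
    schattenDist p w.1 z.1 ≤ schattenDist p (unitaryBlockSum m n w) (unitaryBlockSum m n z) := by
  rw [schattenDist_unitaryBlockSum_eq]
  refine le_of_eq_of_le ?_
    (schattenNorm_submatrix_le (finSumFinEquiv.injective.comp Sum.inl_injective) _)
  rw [schattenDist]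
  congr 1
  ext i j
  simp

theorem schattenDist_snd_le_unitaryBlockSum
    (w z : unitaryGroup (Fin m) ℂ × unitaryGroup (Fin n) ℂ) :
    schattenDist p w.2 z.2 ≤ schattenDist p (unitaryBlockSum m n w) (unitaryBlockSum m n z) := by
  rw [schattenDist_unitaryBlockSum_eq]
  refine le_of_eq_of_le ?_
    (schattenNorm_submatrix_le (finSumFinEquiv.injective.comp Sum.inr_injective) _)
  rw [schattenDist]
  congr 1
  ext i j
  simp

end BlockSum

section Approximation

variable {p q : ℝ≥0∞} {Γ G : Type*} [Group Γ] [Group G] {d e : ℕ → ℕ}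
  {φ : ∀ n, Γ → Matrix.unitaryGroup (Fin (d n)) ℂ} {ψ : ∀ n, Γ → Matrix.unitaryGroup (Fin (e n)) ℂ}

theorem zero_lt_liminf_ofReal_iff {ι : Type*} {l : Filter ι} {f : ι → ℝ} :
    0 < liminf (fun i => ENNReal.ofReal (f i)) l ↔ ∃ c > 0, ∀ᶠ i in l, c ≤ f i := by
  constructor
  · intro h
    obtain ⟨c, hc_pos, hc_lt⟩ := exists_between h
    have hc_top : c ≠ ∞ := hc_lt.ne_top
    refine ⟨c.toReal, ENNReal.toReal_pos hc_pos.ne' hc_top, ?_⟩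
    filter_upwards [eventually_lt_of_lt_liminf hc_lt] with i hi
    have hf_pos : 0 < f i := ENNReal.ofReal_pos.1 (hc_pos.trans hi)
    exact (ENNReal.le_ofReal_iff_toReal_le hc_top hf_pos.le).1 hi.le
  · rintro ⟨c, hc_pos, hc_le⟩
    exact (ENNReal.ofReal_pos.2 hc_pos).trans_le
      (le_liminf_of_le (h := hc_le.mono fun _ => ENNReal.ofReal_le_ofReal))

theorem zero_lt_liminf_ofReal_mono {ι : Type*} {l : Filter ι} {f g : ι → ℝ} (hfg : ∀ i, f i ≤ g i)
    (hf : 0 < liminf (fun i => ENNReal.ofReal (f i)) l) :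
    0 < liminf (fun i => ENNReal.ofReal (g i)) l :=
  hf.trans_le (liminf_le_liminf (.of_forall fun i => ENNReal.ofReal_le_ofReal (hfg i)))

theorem IsAsymptoticHom.comp {ψ : ∀ n, G → Matrix.unitaryGroup (Fin (e n)) ℂ}
    (hψ : IsAsymptoticHom p ψ) (f : Γ →* G) : IsAsymptoticHom p fun n g => ψ n (f g) :=
  fun g h => by simpa only [map_mul] using hψ (f g) (f h)

variable [Fact (1 ≤ p)]

theorem IsAsymptoticHom.mono (hpq : p ≤ q) (hφ : IsAsymptoticHom p φ) : IsAsymptoticHom q φ :=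
  have : Fact (1 ≤ q) := ⟨le_trans Fact.out hpq⟩
  fun g h => squeeze_zero (fun _ => schattenDist_nonneg _ _)
    (fun _ => schattenDist_antitone hpq _ _) (hφ g h)

theorem IsAsymptoticHom.unitaryBlockSum (hφ : IsAsymptoticHom p φ) (hψ : IsAsymptoticHom p ψ) :
    IsAsymptoticHom p fun n g => unitaryBlockSum (d n) (e n) (φ n g, ψ n g) := fun g h => by
  refine squeeze_zero (fun _ => schattenDist_nonneg _ _) (fun n => ?_)
    (by simpa only [add_zero] using (hφ g h).add (hψ g h))
  rw [← map_mul]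
  exact schattenDist_unitaryBlockSum_le _ _

theorem IsAsymptoticHom.tendsto_one (hφ : IsAsymptoticHom p φ) :
    Tendsto (fun n => schattenDist p (φ n 1) 1) atTop (𝓝 0) :=
  (hφ 1 1).congr fun n => by
    rw [schattenDist_comm]
    simpa only [mul_one] using schattenDist_mul_left (φ n 1) (φ n 1) 1

theorem IsAsymptoticHom.tendsto_pow (hφ : IsAsymptoticHom p φ) (g : Γ) (k : ℕ) :
    Tendsto (fun n => schattenDist p (φ n g ^ k) (φ n (g ^ k))) atTop (𝓝 0) := by
  induction k with
  | zero => simpa only [pow_zero, schattenDist_comm] using hφ.tendsto_one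
  | succ k ih =>
    refine squeeze_zero (fun _ => schattenDist_nonneg _ _) (fun n => ?_)
      (by simpa only [add_zero] using ih.add (hφ (g ^ k) g))
    calc schattenDist p (φ n g ^ (k + 1)) (φ n (g ^ (k + 1)))
        ≤ schattenDist p (φ n g ^ k * φ n g) (φ n (g ^ k) * φ n g) +
            schattenDist p (φ n (g ^ k) * φ n g) (φ n (g ^ k * g)) := by
          rw [pow_succ, pow_succ]
          exact schattenDist_triangle _ _ _
      _ = schattenDist p (φ n g ^ k) (φ n (g ^ k)) +
            schattenDist p (φ n (g ^ k * g)) (φ n (g ^ k) * φ n g) := by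
          rw [schattenDist_mul_right, schattenDist_comm (φ n (g ^ k) * φ n g)]

theorem IsAsymptoticHom.tendsto_pow_orderOf (hφ : IsAsymptoticHom p φ) (g : Γ) :
    Tendsto (fun n => schattenDist p (φ n g ^ orderOf g) 1) atTop (𝓝 0) := by
  have h := hφ.tendsto_pow g (orderOf g)
  rw [pow_orderOf_eq_one] at h
  exact squeeze_zero (fun _ => schattenDist_nonneg _ _) (fun n => schattenDist_triangle _ (φ n 1) _)
    (by simpa only [add_zero] using h.add hφ.tendsto_one)

theorem IsAsymptoticHom.zero_lt_liminf_schattenDist_top (hφ : IsAsymptoticHom p φ) {g : Γ}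
    (hg : IsOfFinOrder g)
    (hsep : 0 < liminf (fun n => ENNReal.ofReal (schattenDist p (φ n g) 1)) atTop) :
    0 < liminf (fun n => ENNReal.ofReal (schattenDist ∞ (φ n g) 1)) atTop := by
  rw [zero_lt_liminf_ofReal_iff] at hsep ⊢
  obtain ⟨c, hc, hsep⟩ := hsep
  have hk : (0 : ℝ) < orderOf g := Nat.cast_pos.2 hg.orderOf_pos
  refine ⟨1 / (2 * orderOf g), by positivity, ?_⟩
  filter_upwards [hsep, (hφ.tendsto_pow_orderOf g).eventually_lt_const
    (show 0 < orderOf g * (1 / 2) * c by positivity)] with n hn hpow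
  by_contra! hclose
  have half_le : 1 / 2 ≤ 1 - orderOf g * schattenDist ∞ (φ n g) 1 := by
    rw [lt_div_iff₀ (by positivity)] at hclose
    linarith
  refine hpow.not_ge ?_
  calc orderOf g * (1 / 2) * c
      ≤ orderOf g * (1 - orderOf g * schattenDist ∞ (φ n g) 1) * schattenDist p (φ n g) 1 := by
        gcongr
    _ ≤ schattenDist p (φ n g ^ orderOf g) 1 := mul_schattenDist_le_schattenDist_pow _ _

theorem IsSchattenApproximated.of_torsion_ker (hpq : p ≤ q) (f : Γ →* G)
    (hf : ∀ g ∈ f.ker, IsOfFinOrder g) (hG : IsSchattenApproximated q G)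
    (hΓ : IsSchattenApproximated p Γ) : IsSchattenApproximated q Γ := by
  have : Fact (1 ≤ q) := ⟨le_trans Fact.out hpq⟩
  obtain ⟨d, φ, hφ, φ_separates⟩ := hΓ
  obtain ⟨e, ψ, hψ, ψ_separates⟩ := hG
  refine ⟨fun n => d n + e n, fun n g => unitaryBlockSum (d n) (e n) (φ n g, ψ n (f g)),
    (hφ.mono hpq).unitaryBlockSum (hψ.comp f), fun g hg => ?_⟩
  simp only [← map_one (unitaryBlockSum _ _)]
  by_cases hgf : f g = 1
  · exact zero_lt_liminf_ofReal_mono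
      (fun n => (schattenDist_antitone le_top _ _).trans (schattenDist_fst_le_unitaryBlockSum _ 1))
      (hφ.zero_lt_liminf_schattenDist_top (hf g hgf) (φ_separates g hg))
  · exact zero_lt_liminf_ofReal_mono (fun n => schattenDist_snd_le_unitaryBlockSum _ 1)
      (ψ_separates (f g) hgf)

end Approximation

section ResiduallyFinite

open scoped Matrix.Norms.L2Operator

variable {p : ℝ≥0∞} [Fact (1 ≤ p)]

/-- The representation of the symmetric group by permutation matrices, with values in the unitary
group. -/
def permUnitary (d : ℕ) : Equiv.Perm (Fin d) →* Matrix.unitaryGroup (Fin d) ℂ :=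
  (Matrix.permMatrixHom (R := ℂ)).codRestrict (Matrix.unitaryGroup (Fin d) ℂ) fun σ => by
    rw [Matrix.mem_unitaryGroup_iff, Matrix.star_eq_conjTranspose, Matrix.permMatrixHom_apply,
      Matrix.conjTranspose_permMatrix, ← Matrix.permMatrix_mul]
    simp

theorem permUnitary_apply_self_eq_zero {d : ℕ} {σ : Equiv.Perm (Fin d)} {i : Fin d}
    (hi : σ i ≠ i) : (permUnitary d σ : Matrix (Fin d) (Fin d) ℂ) i i = 0 := by
  have hi' : σ⁻¹ i ≠ i := fun h => hi (Equiv.Perm.inv_eq_iff_eq.1 h).symm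
  calc (permUnitary d σ : Matrix (Fin d) (Fin d) ℂ) i i = (σ⁻¹).permMatrix ℂ i i := rfl
    _ = 0 := by
      rw [Equiv.Perm.permMatrix, PEquiv.toMatrix_apply, Equiv.toPEquiv_apply]
      simpa using hi'

theorem one_le_schattenDist_permUnitary {d : ℕ} {σ : Equiv.Perm (Fin d)} (hσ : σ ≠ 1) :
    1 ≤ schattenDist p (permUnitary d σ) 1 := by
  obtain ⟨i, hi⟩ : ∃ i, σ i ≠ i := not_forall.1 fun h => hσ (Equiv.ext h)
  calc (1 : ℝ) = ‖((permUnitary d σ : Matrix (Fin d) (Fin d) ℂ) - 1) i i‖ := by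
        simp [permUnitary_apply_self_eq_zero hi]
    _ ≤ ‖(permUnitary d σ : Matrix (Fin d) (Fin d) ℂ) - 1‖ := norm_entry_le_l2_opNorm _ i i
    _ = schattenDist ∞ (permUnitary d σ) 1 := by
        rw [schattenDist, schattenNorm, if_pos rfl, OneMemClass.coe_one]
    _ ≤ schattenDist p (permUnitary d σ) 1 := schattenDist_antitone le_top _ _

theorem exists_injective_hom_perm (G : Type*) [Group G] [Finite G] :
    ∃ (d : ℕ) (f : G →* Equiv.Perm (Fin d)), Function.Injective f :=
  ⟨Nat.card G, ((Finite.equivFin G).permCongrHom.toMonoidHom).comp (MulAction.toPermHom G G),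
    (Finite.equivFin G).permCongrHom.injective.comp MulAction.toPerm_injective⟩

theorem IsSchattenApproximated.of_homs_to_finite {G : Type*} [Group G] {F : ℕ → Type*}
    [∀ n, Group (F n)] [∀ n, Finite (F n)] (f : ∀ n, G →* F n)
    (hf : ∀ g ≠ 1, ∀ᶠ n in atTop, f n g ≠ 1) : IsSchattenApproximated p G := by
  choose d ρ hρ using fun n => exists_injective_hom_perm (F n)
  refine ⟨d, fun n g => permUnitary (d n) (ρ n (f n g)), fun g h => ?_, fun g hg => ?_⟩
  · simp only [map_mul, schattenDist_self, tendsto_const_nhds]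
  · exact zero_lt_liminf_ofReal_iff.2 ⟨1, one_pos, (hf g hg).mono fun n hn =>
      one_le_schattenDist_permUnitary ((map_ne_one_iff _ (hρ n)).2 hn)⟩

theorem IsSchattenApproximated.of_residuallyFinite {G : Type*} [Group G] [Countable G]
    [Group.ResiduallyFinite G] : IsSchattenApproximated p G := by
  have : Nonempty (FiniteIndexNormalSubgroup G) := ⟨.ofSubgroup ⊤⟩
  choose! K hK using Group.exists_finiteIndexNormalSubgroup_notMem (G := G)
  obtain ⟨e, he⟩ := exists_surjective_nat G
  let quotientMap (n : ℕ) : G →* ∀ i : Finset.range (n + 1), G ⧸ (K (e i)).toSubgroup :=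
    MonoidHom.pi fun i => QuotientGroup.mk' (K (e i)).toSubgroup
  refine .of_homs_to_finite quotientMap fun g hg => ?_
  obtain ⟨k, rfl⟩ := he g
  filter_upwards [eventually_ge_atTop k] with n hn h_one
  exact hK _ hg ((QuotientGroup.eq_one_iff _).1
    (congrFun h_one ⟨k, Finset.mem_range_succ_iff.2 hn⟩))

theorem countable_of_fg (G : Type*) [Group G] [hG : Group.FG G] : Countable G := by
  obtain ⟨α, _, f, hf⟩ := Group.fg_iff_exists_freeGroup_hom_surjective_finite.1 hG
  exact hf.countable

end ResiduallyFinite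

theorem mainTheorem5_general {Γ : Type*} [Group Γ] (N : Subgroup Γ) [N.Normal]
    (hN : IsMulTorsion N) :
    (∀ p q : ℝ≥0∞, 1 ≤ p → p ≤ q → IsSchattenApproximated q (Γ ⧸ N) →
      IsSchattenApproximated p Γ → IsSchattenApproximated q Γ) ∧
    (Countable (Γ ⧸ N) → Group.ResiduallyFinite (Γ ⧸ N) →
      ∀ p q : ℝ≥0∞, 1 ≤ p → p ≤ q →
        IsSchattenApproximated p Γ → IsSchattenApproximated q Γ) := by
  have ker_torsion (g : Γ) (hg : g ∈ (QuotientGroup.mk' N).ker) : IsOfFinOrder g := by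
    rw [QuotientGroup.ker_mk'] at hg
    exact N.subtype.isOfFinOrder (hN ⟨g, hg⟩)
  have lift {p q : ℝ≥0∞} (hp : 1 ≤ p) (hpq : p ≤ q) (hq : IsSchattenApproximated q (Γ ⧸ N)) :
      IsSchattenApproximated p Γ → IsSchattenApproximated q Γ :=
    have : Fact (1 ≤ p) := ⟨hp⟩
    .of_torsion_ker hpq (QuotientGroup.mk' N) ker_torsion hq
  refine ⟨fun p q => lift, fun _ _ p q hp hpq => lift hp hpq ?_⟩
  have : Fact (1 ≤ q) := ⟨hp.trans hpq⟩
  exact .of_residuallyFinite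

theorem mainTheorem5 {Γ : Type*} [Group Γ] [Group.FG Γ] (N : Subgroup Γ) [N.Normal] [Finite N] :
    (∀ p q : ℝ≥0∞, 1 ≤ p → p ≤ q → IsSchattenApproximated q (Γ ⧸ N) →
      IsSchattenApproximated p Γ → IsSchattenApproximated q Γ) ∧
    (Group.ResiduallyFinite (Γ ⧸ N) →
      ∀ p q : ℝ≥0∞, 1 ≤ p → p ≤ q →
        IsSchattenApproximated p Γ → IsSchattenApproximated q Γ) :=
  have := countable_of_fg Γ
  (mainTheorem5_general N isOfFinOrder_of_finite).imp_right fun h =>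
    h (QuotientGroup.mk_surjective (s := N)).countable
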